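/- For a finite group $G$, a positive integer $m$ and $u,g\in G$ put $G_m(u,g)=\{a\in G : a^m=(au)^m=g\}$. Call $G$ an $FSZ_m$ group if $|G_m(u,g)|=|G_m(u,g^n)|$ for all $u,g\in G$ and all positive integers $n$ coprime to $|G|$, and call $G$ an $FSZ$ group if it is $FSZ_m$ for every positive integer $m$. For a group $D$ and a prime $p$ let $D\wr_r\mathbb{Z}_p$ be the regular wreath product, that is, the semidirect product $D^p\rtimes\mathbb{Z}_p$ in which the cyclic group $\mathbb{Z}_p$ of order $p$ acts by cyclically permuting the factors of $D^p$. **Theorem.** Let $p$ be a prime. Then $(\mathbb{Z}_p\wr_r\mathbb{Z}_p)\wr_r\mathbb{Z}_p$ is $FSZ$. In particular, every Sylow $p$-subgroup of the symmetric group $S_{p^3}$ is $FSZ$. -/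

import Mathlib

namespace FSZGroups

/-- The set `G_m(u, g) = {a ∈ G : a ^ m = (a u) ^ m = g}`. -/
def powerSet {G : Type*} [Group G] (m : ℕ) (u g : G) : Set G :=
  {a : G | a ^ m = g ∧ (a * u) ^ m = g}

/-- A finite group `G` is `FSZ_m` if, for every positive integer `n` coprime to `|G|`,
`|G_m(u, g)| = |G_m(u, g ^ n)|` for all `u, g ∈ G`. -/
def IsFSZAt (G : Type*) [Group G] [Finite G] (m : ℕ) : Prop :=
  ∀ n : ℕ, 0 < n → Nat.Coprime n (Nat.card G) →
    ∀ u g : G, (powerSet m u g).ncard = (powerSet m u (g ^ n)).ncard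

/-- A finite group is `FSZ` if it is `FSZ_m` for every positive integer `m`. -/
def IsFSZ (G : Type*) [Group G] [Finite G] : Prop :=
  ∀ m : ℕ, 0 < m → IsFSZAt G m

end FSZGroups

/-!
Let `c` be a diagonal element of a group of monomial matrices commuting with `a`, and let `T` meet
each cycle of `a` on the support of `c` exactly once. If these cycles have length `m`, multiplying
`a` by the part of `c` supported on `T` multiplies `a ^ m` by `c`. When all cycles have the same
length, Hall's theorem provides a common `T` for `a` and `a * u`, so that `a ↦ c|_T * a` embeds
`G_m(u, g)` into `G_m(u, g * c)`; now take `c = g⁻¹ * g ^ n`.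

For `G = (C ≀ᵣ Q) ≀ᵣ R` with `C`, `Q`, `R` of exponent `p` and `m` a power of `p`, it remains to
view `G` as a group of monomial matrices in which `g` is diagonal and the roots of `g` have cycles
of length `m`. If `g` is diagonal over `C`, then a cycle of a root of `g` of length less than `m`
would make the corresponding entries of `g` `p`-th powers in `C`, hence trivial. Otherwise view `G`
as monomial over `C ≀ᵣ Q`: a root `a` of `g` with `a.right ^ (m / p) = 1` would make `g` the `p`-th
power of an element of `(C ≀ᵣ Q) ^ R`, hence diagonal over `C`, so all cycles of `a` on `R` have
length `m`. The only further case is `m = 1`, where every `g` is diagonal of size one over `G`.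
-/

namespace FSZGroups

section Transversal

open Finset Function

variable {X I J : Type*} [Fintype X] [DecidableEq I] {f : X → I} {h : X → J} {m : ℕ}

theorem card_filter_mem_of_card_fiber (hf : ∀ i, #{x | f x = i} = m) (A : Finset I) :
    #{x | f x ∈ A} = #A * m := by
  simp only [← sum_card_fiberwise_eq_card_filter, hf, sum_const, smul_eq_mul]

theorem surjective_of_card_fiber (hm : 0 < m) (hf : ∀ i, #{x | f x = i} = m) : Surjective f := by
  intro i
  obtain ⟨x, hx⟩ := card_pos.1 (hm.trans_eq (hf i).symm)
  exact ⟨x, mem_filter_univ x |>.1 hx⟩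

theorem exists_bijOn_of_card_fiber [DecidableEq J] (hm : 0 < m)
    (hf : ∀ i, #{x | f x = i} = m) (hh : ∀ j, #{x | h x = j} = m) :
    ∃ T : Set X, T.BijOn f Set.univ ∧ T.BijOn h Set.univ := by
  have := Fintype.ofSurjective f (surjective_of_card_fiber hm hf)
  have := Fintype.ofSurjective h (surjective_of_card_fiber hm hh)
  let meets (i : I) : Finset J := image h {x | f x = i}
  have hall (A : Finset I) : #A ≤ #(A.biUnion meets) := by
    refine Nat.le_of_mul_le_mul_right ?_ hm
    rw [← card_filter_mem_of_card_fiber hf, ← card_filter_mem_of_card_fiber hh]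
    refine card_le_card fun x hx => ?_
    simp only [mem_filter_univ, mem_biUnion, mem_image, meets] at hx ⊢
    exact ⟨f x, hx, x, rfl, rfl⟩
  obtain ⟨e, e_inj, he⟩ := (all_card_le_biUnion_card_iff_exists_injective meets).1 hall
  have card_eq : Fintype.card I = Fintype.card J := by
    refine Nat.eq_of_mul_eq_mul_right hm ?_
    rw [← card_univ, ← card_univ, ← card_filter_mem_of_card_fiber hf,
      ← card_filter_mem_of_card_fiber hh]
    simp only [mem_univ]
  have e_bij : Bijective e := (Fintype.bijective_iff_injective_and_card e).2 ⟨e_inj, card_eq⟩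
  have exists_rep (i : I) : ∃ x, f x = i ∧ h x = e i := by
    simpa only [meets, mem_image, mem_filter_univ] using he i
  choose rep f_rep h_rep using exists_rep
  have rep_inj : Injective rep := LeftInverse.injective f_rep
  refine ⟨Set.range rep, ?_, ?_⟩ <;> rw [← Set.image_univ, ← Set.bijOn_comp_iff rep_inj.injOn]
  · rw [show f ∘ rep = id from funext f_rep]
    exact Set.bijOn_id _
  · rw [show h ∘ rep = e from funext h_rep]
    exact Set.bijOn_univ.2 e_bij

end Transversal

section Cycle

open Function Equiv.Perm

theorem sameCycle_iff_exists_iterate_eq {X : Type*} [Finite X] {π : Equiv.Perm X} {x y : X} :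
    π.SameCycle x y ↔ ∃ i < minimalPeriod π x, π^[i] x = y := by
  refine ⟨fun h => ?_, fun ⟨i, _, hi⟩ => ⟨i, by rwa [zpow_natCast, ← iterate_eq_pow]⟩⟩
  obtain ⟨i, hi⟩ := h.exists_nat_pow_eq
  refine ⟨i % minimalPeriod π x, Nat.mod_lt _ ?_, ?_⟩
  · exact minimalPeriod_pos_of_mem_periodicPts (π.injective.mem_periodicPts x)
  · rw [iterate_mod_minimalPeriod_eq, iterate_eq_pow, hi]

/-- `T` meets the forward orbit under `f` of each point of `S` exactly once per period. -/
def IsCycleTransversal {X : Type*} (f : X → X) (S T : Set X) : Prop :=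
  ∀ x ∈ S, ∃! i, i < minimalPeriod f x ∧ f^[i] x ∈ T

variable {X : Type*} [Finite X] {π σ : Equiv.Perm X} {m : ℕ} {S T : Set X}

theorem card_filter_sameCycle_mk_eq {X : Type*} [Fintype X] {π : Equiv.Perm X}
    [DecidableEq (Quotient (SameCycle.setoid π))] (x : X) :
    Finset.card {y | (⟦y⟧ : Quotient (SameCycle.setoid π)) = ⟦x⟧} = minimalPeriod π x := by
  classical
  have fiber_eq : ({y | (⟦y⟧ : Quotient (SameCycle.setoid π)) = ⟦x⟧} : Finset X) =
      (Finset.range (minimalPeriod π x)).image fun i => π^[i] x := by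
    ext y
    simp only [Finset.mem_filter_univ, Finset.mem_image, Finset.mem_range]
    rw [eq_comm, Quotient.eq]
    exact sameCycle_iff_exists_iterate_eq
  rw [fiber_eq, Finset.card_image_of_injOn, Finset.card_range]
  simpa only [Finset.coe_range] using iterate_injOn_Iio_minimalPeriod

theorem isCycleTransversal_univ_of_bijOn
    (hT : T.BijOn (Quotient.mk (SameCycle.setoid π)) Set.univ) :
    IsCycleTransversal π Set.univ T := by
  intro x _
  obtain ⟨y, hyT, hyx⟩ := hT.surjOn (Set.mem_univ ⟦x⟧)
  obtain ⟨i, hi, rfl⟩ := sameCycle_iff_exists_iterate_eq.1 (Quotient.exact hyx.symm)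
  refine ⟨i, ⟨hi, hyT⟩, fun j ⟨hj, hjT⟩ => iterate_injOn_Iio_minimalPeriod hj hi ?_⟩
  refine hT.injOn hjT hyT (Eq.trans ?_ hyx.symm)
  exact (Quotient.sound (sameCycle_iff_exists_iterate_eq.2 ⟨j, hj, rfl⟩)).symm

theorem exists_common_isCycleTransversal_univ (hπ : ∀ x, minimalPeriod π x = m)
    (hσ : ∀ x, minimalPeriod σ x = m) :
    ∃ T : Set X, IsCycleTransversal π Set.univ T ∧ IsCycleTransversal σ Set.univ T := by
  classical
  have := Fintype.ofFinite X
  have card_fiber {τ : Equiv.Perm X} (hτ : ∀ x, minimalPeriod τ x = m) :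
      ∀ c, Finset.card {y | Quotient.mk (SameCycle.setoid τ) y = c} = m :=
    Quotient.ind fun x => (card_filter_sameCycle_mk_eq x).trans (hτ x)
  obtain _ | ⟨⟨x⟩⟩ := isEmpty_or_nonempty X
  · exact ⟨∅, fun x => isEmptyElim x, fun x => isEmptyElim x⟩
  have m_pos : 0 < m := hπ x ▸ minimalPeriod_pos_of_mem_periodicPts (π.injective.mem_periodicPts x)
  obtain ⟨T, hTπ, hTσ⟩ := exists_bijOn_of_card_fiber m_pos (card_fiber hπ) (card_fiber hσ)
  exact ⟨T, isCycleTransversal_univ_of_bijOn hTπ, isCycleTransversal_univ_of_bijOn hTσ⟩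

theorem coe_iterate_subtypePerm {X : Type*} {π : Equiv.Perm X} {S : Set X}
    (hπ : ∀ x, π x ∈ S ↔ x ∈ S) (i : ℕ) (x : S) : ((π.subtypePerm hπ)^[i] x : S) = π^[i] (x : X) :=
  Semiconj.iterate_right (f := Subtype.val) (fun _ => rfl) i x

theorem minimalPeriod_subtypePerm {X : Type*} {π : Equiv.Perm X} {S : Set X}
    (hπ : ∀ x, π x ∈ S ↔ x ∈ S) (x : S) :
    minimalPeriod (π.subtypePerm hπ) x = minimalPeriod π x :=
  minimalPeriod_eq_minimalPeriod_iff.2 fun n => by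
    rw [IsPeriodicPt, IsPeriodicPt, IsFixedPt, IsFixedPt, ← coe_iterate_subtypePerm hπ,
      Subtype.val_inj]

theorem exists_common_isCycleTransversal (hπS : ∀ x, π x ∈ S ↔ x ∈ S) (hσS : ∀ x, σ x ∈ S ↔ x ∈ S)
    (hπ : ∀ x ∈ S, minimalPeriod π x = m) (hσ : ∀ x ∈ S, minimalPeriod σ x = m) :
    ∃ T : Set X, IsCycleTransversal π S T ∧ IsCycleTransversal σ S T := by
  obtain ⟨T, hTπ, hTσ⟩ := exists_common_isCycleTransversal_univ (m := m)
    (fun x => (minimalPeriod_subtypePerm hπS x).trans (hπ x x.2))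
    (fun x => (minimalPeriod_subtypePerm hσS x).trans (hσ x x.2))
  have image_val {τ : Equiv.Perm X} {hτ : ∀ x, τ x ∈ S ↔ x ∈ S}
      (hT : IsCycleTransversal (τ.subtypePerm hτ) Set.univ T) :
      IsCycleTransversal τ S (Subtype.val '' T) := fun x hx => by
    simpa only [minimalPeriod_subtypePerm, ← coe_iterate_subtypePerm hτ _ ⟨x, hx⟩,
      Subtype.val_injective.mem_set_image] using hT ⟨x, hx⟩ (Set.mem_univ _)
  exact ⟨_, image_val hTπ, image_val hTσ⟩

end Cycle

section MonomialAction

open Function MulAction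

theorem mem_ker_toPermHom {G Ω : Type*} [Group G] [MulAction G Ω] {g : G} :
    g ∈ (toPermHom G Ω).ker ↔ ∀ x : Ω, g • x = x := by
  simp only [MonoidHom.mem_ker, Equiv.ext_iff, toPermHom_apply, toPerm_apply, Equiv.Perm.one_apply]

theorem minimalPeriod_smul_eq_prime_pow {G Ω : Type*} [Group G] [MulAction G Ω] {p k : ℕ}
    [Fact p.Prime] {a : G} {x : Ω} (h_ne : a ^ p ^ k • x ≠ x) (h_eq : a ^ p ^ (k + 1) • x = x) :
    minimalPeriod (a • ·) x = p ^ (k + 1) := by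
  apply minimalPeriod_eq_prime_pow <;> rwa [IsPeriodicPt, IsFixedPt, smul_iterate_apply]

/-- A presentation of `G` as a group of monomial matrices with rows and columns indexed by `Ω` and
nonzero entries in the possibly nonabelian group `C`, containing all diagonal matrices. The action
of `G` on `Ω` is the underlying permutation action. -/
structure MonomialAction (C G Ω : Type*) [Group C] [Group G] [MulAction G Ω] where
  /-- The nonzero entry of a monomial matrix in the column `x`, lying in the row `g • x`. -/
  entry : G → Ω → C
  entry_mul (g h : G) (x : Ω) : entry (g * h) x = entry g (h • x) * entry h x
  /-- The diagonal matrix with given entries. -/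
  diag : (Ω → C) → G
  diag_smul (f : Ω → C) (x : Ω) : diag f • x = x
  entry_diag (f : Ω → C) (x : Ω) : entry (diag f) x = f x
  ext {g h : G} : (∀ x : Ω, g • x = h • x) → (∀ x, entry g x = entry h x) → g = h

namespace MonomialAction

/-- A group as the monomial matrices of size one over itself. -/
def onePoint (G : Type*) [Group G] : MonomialAction G G Unit where
  entry g _ := g
  entry_mul _ _ _ := rfl
  diag f := f ()
  diag_smul _ _ := rfl
  entry_diag _ _ := rfl
  ext _ h := h ()

variable {C G Ω : Type*} [Group C] [Group G] [MulAction G Ω]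

/-- The wreath product of a group of monomial matrices with `Q`, as monomial matrices of size
`Ω × Q`. -/
def wreath [Nonempty Ω] (M : MonomialAction C G Ω) (Q : Type*) [Group Q] :
    MonomialAction C (G ≀ᵣ Q) (Ω × Q) where
  entry a x := M.entry (a.left (a.right * x.2)) x.1
  entry_mul a b x := by simp [M.entry_mul, mul_assoc]
  diag f := ⟨fun q => M.diag fun x => f (x, q), 1⟩
  diag_smul f x := by ext <;> simp [M.diag_smul]
  entry_diag f x := by simp [M.entry_diag]
  ext {a b} h_smul h_entry := by
    obtain ⟨x₀⟩ := ‹Nonempty Ω›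
    have right_eq : a.right = b.right := by simpa using congrArg Prod.snd (h_smul (x₀, 1))
    refine RegularWreathProduct.ext (funext fun q => M.ext (fun x => ?_) fun x => ?_) right_eq
    · simpa [right_eq] using congrArg Prod.fst (h_smul (x, b.right⁻¹ * q))
    · simpa [right_eq] using h_entry (x, b.right⁻¹ * q)

variable (M : MonomialAction C G Ω)

theorem entry_one (x : Ω) : M.entry 1 x = 1 := by
  simpa using M.entry_mul 1 1 x

theorem entry_pow_of_smul_eq {g : G} {x : Ω} (h : g • x = x) (n : ℕ) :
    M.entry (g ^ n) x = M.entry g x ^ n := by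
  induction n with
  | zero => simp only [pow_zero, M.entry_one]
  | succ n ih => rw [pow_succ, M.entry_mul, h, ih, pow_succ]

theorem pow_eq_one_of_mem_ker (M : MonomialAction C G Ω) {g : G}
    (hg : g ∈ (toPermHom G Ω).ker) {n : ℕ} (hC : ∀ c : C, c ^ n = 1) : g ^ n = 1 := by
  refine M.ext (fun x => ?_) fun x => ?_
  · rw [mem_ker_toPermHom.1 (pow_mem hg n), one_smul]
  · rw [M.entry_pow_of_smul_eq (mem_ker_toPermHom.1 hg x), hC, M.entry_one]

theorem semiconjBy_entry_of_commute {a c : G} (hc : c ∈ (toPermHom G Ω).ker) (h : Commute a c)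
    (x : Ω) : SemiconjBy (M.entry a x) (M.entry c x) (M.entry c (a • x)) := by
  have entry_eq := congrArg (M.entry · x) h.eq
  rwa [M.entry_mul, M.entry_mul, mem_ker_toPermHom.1 hc] at entry_eq

theorem smul_mem_mulSupport_entry_iff {a c : G} (hc : c ∈ (toPermHom G Ω).ker) (h : Commute a c)
    (x : Ω) : a • x ∈ mulSupport (M.entry c) ↔ x ∈ mulSupport (M.entry c) := by
  have semiconj := M.semiconjBy_entry_of_commute hc h x
  rw [mem_mulSupport, mem_mulSupport, not_iff_not]
  refine ⟨fun hax => ?_, fun hx => ?_⟩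
  · rwa [hax, SemiconjBy, one_mul, mul_eq_left] at semiconj
  · rwa [hx, SemiconjBy, mul_one, right_eq_mul] at semiconj

/-- The diagonal matrix that has the entries of `c` at the points of `T` and `1` elsewhere. -/
noncomputable def restrict (c : G) (T : Set Ω) : G :=
  M.diag (T.mulIndicator (M.entry c))

theorem restrict_mul_smul (c a : G) (T : Set Ω) (x : Ω) : (M.restrict c T * a) • x = a • x := by
  rw [mul_smul, restrict, M.diag_smul]

theorem restrict_mul_pow_smul (c a : G) (T : Set Ω) (n : ℕ) (x : Ω) :
    (M.restrict c T * a) ^ n • x = a ^ n • x := by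
  simp only [← smul_iterate_apply, restrict_mul_smul]

open Classical in
theorem entry_restrict_mul_pow {a c : G} (hc : c ∈ (toPermHom G Ω).ker) (h : Commute a c)
    (T : Set Ω) (n : ℕ) (x : Ω) :
    M.entry ((M.restrict c T * a) ^ n) x =
      M.entry (a ^ n) x * M.entry c x ^ Nat.count (fun i => a ^ i • a • x ∈ T) n := by
  induction n with
  | zero => simp only [pow_zero, M.entry_one, Nat.count_zero, mul_one]
  | succ n ih =>
    have smul_comm : a ^ n • a • x = a • a ^ n • x := by simp only [← mul_smul, pow_mul_comm']
    calc
      _ = M.entry (M.restrict c T * a) (a ^ n • x) * M.entry ((M.restrict c T * a) ^ n) x := by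
        rw [pow_succ', M.entry_mul, restrict_mul_pow_smul]
      _ = T.mulIndicator (M.entry c) (a ^ n • a • x) *
          (M.entry (a ^ (n + 1)) x * M.entry c x ^ Nat.count (fun i => a ^ i • a • x ∈ T) n) := by
        rw [ih, M.entry_mul, restrict, M.entry_diag, pow_succ', M.entry_mul a, smul_comm]
        simp only [mul_assoc]
      _ = _ := by
        rw [Nat.count_succ, Set.mulIndicator]
        split_ifs with hT
        · have conj : SemiconjBy (M.entry (a ^ (n + 1)) x) (M.entry c x)
              (M.entry c (a ^ n • a • x)) := by
            rw [smul_smul, ← pow_succ]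
            exact M.semiconjBy_entry_of_commute hc (h.pow_left (n + 1)) x
          rw [← mul_assoc, ← conj.eq, mul_assoc, ← pow_succ']
        · rw [one_mul, add_zero]

theorem restrict_mul_pow_eq {a c : G} {m : ℕ} (hc : c ∈ (toPermHom G Ω).ker) (h : Commute a c)
    (hm : ∀ x ∈ mulSupport (M.entry c), minimalPeriod (a • ·) x = m) {T : Set Ω}
    (hT : IsCycleTransversal (a • ·) (mulSupport (M.entry c)) T) :
    (M.restrict c T * a) ^ m = a ^ m * c := by
  classical
  refine M.ext (fun x => ?_) fun x => ?_
  · rw [restrict_mul_pow_smul, mul_smul, mem_ker_toPermHom.1 hc]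
  rw [M.entry_restrict_mul_pow hc h, M.entry_mul, mem_ker_toPermHom.1 hc]
  obtain hx | hx := eq_or_ne (M.entry c x) 1
  · rw [hx, one_pow]
  have hax : a • x ∈ mulSupport (M.entry c) := (M.smul_mem_mulSupport_entry_iff hc h x).2 hx
  have count_eq_one : Nat.count (fun i => a ^ i • a • x ∈ T) m = 1 := by
    rw [Nat.count_eq_card_filter_range, Finset.card_eq_one, Finset.singleton_iff_unique_mem]
    simpa only [Finset.mem_filter, Finset.mem_range, hm _ hax, smul_iterate_apply] using hT _ hax
  rw [count_eq_one, pow_one]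

theorem exists_common_isCycleTransversal [Finite Ω] {a b c : G} {m : ℕ}
    (hc : c ∈ (toPermHom G Ω).ker) (hac : Commute a c) (hbc : Commute b c)
    (ha : ∀ x ∈ mulSupport (M.entry c), minimalPeriod (a • ·) x = m)
    (hb : ∀ x ∈ mulSupport (M.entry c), minimalPeriod (b • ·) x = m) :
    ∃ T : Set Ω, IsCycleTransversal (a • ·) (mulSupport (M.entry c)) T ∧
      IsCycleTransversal (b • ·) (mulSupport (M.entry c)) T :=
  FSZGroups.exists_common_isCycleTransversal (π := toPerm a) (σ := toPerm b)
    (M.smul_mem_mulSupport_entry_iff hc hac) (M.smul_mem_mulSupport_entry_iff hc hbc) ha hb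

theorem ncard_powerSet_le_ncard_powerSet_mul [Finite G] [Finite Ω] {m : ℕ} {c g : G}
    (hc : c ∈ (toPermHom G Ω).ker) (hcomm : ∀ a, a ^ m = g → Commute a c)
    (hm : ∀ a, a ^ m = g → ∀ x ∈ mulSupport (M.entry c), minimalPeriod (a • ·) x = m) (u : G) :
    (powerSet m u g).ncard ≤ (powerSet m u (g * c)).ncard := by
  have exists_transversal (φ : Ω → Ω) : ∃ T : Set Ω, ∀ a ∈ powerSet m u g, (a • · : Ω → Ω) = φ →
      IsCycleTransversal (a • ·) (mulSupport (M.entry c)) T ∧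
        IsCycleTransversal ((a * u) • ·) (mulSupport (M.entry c)) T := by
    by_cases hφ : ∃ a ∈ powerSet m u g, (a • · : Ω → Ω) = φ
    · obtain ⟨a, ⟨ha, hau⟩, rfl⟩ := hφ
      obtain ⟨T, hT⟩ :=
        M.exists_common_isCycleTransversal hc (hcomm _ ha) (hcomm _ hau) (hm _ ha) (hm _ hau)
      refine ⟨T, fun b _ hba => ?_⟩
      simpa only [mul_smul, funext_iff.1 hba] using hT
    · exact ⟨∅, fun a ha h => absurd ⟨a, ha, h⟩ hφ⟩
  choose T hT using exists_transversal
  refine Set.ncard_le_ncard_of_injOn (fun a => M.restrict c (T (a • ·)) * a) ?_ ?_ (Set.toFinite _)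
  · intro a ha
    obtain ⟨hTa, hTau⟩ := hT _ a ha rfl
    obtain ⟨ha, hau⟩ := ha
    refine ⟨?_, ?_⟩
    · rw [M.restrict_mul_pow_eq hc (hcomm _ ha) (hm _ ha) hTa, ha]
    · rw [mul_assoc, M.restrict_mul_pow_eq hc (hcomm _ hau) (hm _ hau) hTau, hau]
  · -- `a` and `c|_T * a` induce the same permutation, which determines `T`.
    intro a _ b _ hab
    have smul_eq : (a • · : Ω → Ω) = (b • ·) := funext fun x => by
      simpa only [restrict_mul_smul] using congrArg (· • x) hab
    simpa only [smul_eq, mul_right_inj] using hab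

theorem ncard_powerSet_le_ncard_powerSet_pow [Finite G] [Finite Ω] {m : ℕ} {g : G}
    (hg : g ∈ (toPermHom G Ω).ker)
    (hm : ∀ a, a ^ m = g → ∀ x ∈ mulSupport (M.entry g), minimalPeriod (a • ·) x = m) (u : G)
    (n : ℕ) : (powerSet m u g).ncard ≤ (powerSet m u (g ^ n)).ncard := by
  have c_mem : g⁻¹ * g ^ n ∈ (toPermHom G Ω).ker := mul_mem (inv_mem hg) (pow_mem hg n)
  have entry_mul_entry (x : Ω) : M.entry g x * M.entry (g⁻¹ * g ^ n) x = M.entry g x ^ n :=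
    calc
      _ = M.entry (g * (g⁻¹ * g ^ n)) x := by rw [M.entry_mul g, mem_ker_toPermHom.1 c_mem]
      _ = M.entry g x ^ n := by
        rw [mul_inv_cancel_left, M.entry_pow_of_smul_eq (mem_ker_toPermHom.1 hg x)]
  rw [← mul_inv_cancel_left g (g ^ n)]
  refine M.ncard_powerSet_le_ncard_powerSet_mul c_mem ?_ (fun a ha x hx => hm a ha x ?_) u
  · rintro a rfl
    have h := Commute.self_pow a m
    exact h.inv_right.mul_right (h.pow_right n)
  · refine fun hgx => hx ?_
    simpa only [hgx, one_mul, one_pow] using entry_mul_entry x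

theorem minimalPeriod_eq_prime_pow_of_pow_mem_ker {p k : ℕ} [Fact p.Prime]
    (hC : ∀ c : C, c ^ p = 1) {a : G} (ha : a ^ p ^ (k + 1) ∈ (toPermHom G Ω).ker) {x : Ω}
    (hx : x ∈ mulSupport (M.entry (a ^ p ^ (k + 1)))) :
    minimalPeriod (a • ·) x = p ^ (k + 1) := by
  refine minimalPeriod_smul_eq_prime_pow (fun h => hx ?_) (mem_ker_toPermHom.1 ha x)
  rw [pow_succ, pow_mul, M.entry_pow_of_smul_eq h, hC]

end MonomialAction

end MonomialAction

section Reduction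

theorem powerSet_mul_pow_of_coprime {G : Type*} [Group G] {k : ℕ} (hk : (Nat.card G).Coprime k)
    (m : ℕ) (u g : G) : powerSet (m * k) u (g ^ k) = powerSet m u g := by
  have pow_inj {a b : G} : a ^ k = b ^ k ↔ a = b := (powCoprime hk).injective.eq_iff
  simp only [powerSet, pow_mul, pow_inj]

theorem isFSZ_of_forall_ncard_le {G : Type*} [Group G] [Finite G] {p : ℕ} [hp : Fact p.Prime]
    (hG : IsPGroup p G)
    (h : ∀ (j : ℕ) (u g : G) (n : ℕ),
      (powerSet (p ^ j) u g).ncard ≤ (powerSet (p ^ j) u (g ^ n)).ncard) : IsFSZ G := by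
  intro m hm n _ hn u g
  obtain ⟨j, k, hk, rfl⟩ := Nat.exists_eq_pow_mul_and_not_dvd hm.ne' p hp.out.ne_one
  have k_coprime : (Nat.card G).Coprime k := by
    obtain ⟨i, hi⟩ := IsPGroup.iff_card.1 hG
    exact hi ▸ (hp.out.coprime_iff_not_dvd.2 hk).pow_left i
  obtain ⟨d, rfl⟩ := (powCoprime k_coprime).surjective g
  rw [powCoprime_apply, pow_right_comm, powerSet_mul_pow_of_coprime k_coprime,
    powerSet_mul_pow_of_coprime k_coprime]
  obtain ⟨r, hr⟩ := exists_pow_eq_self_of_coprime (hn.coprime_dvd_right (orderOf_dvd_natCard d))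
  -- `r` inverts `n` modulo the order of `d`, so that the opposite inequality is an instance of `h`.
  refine (h j u d n).antisymm ?_
  simpa only [hr] using h j u (d ^ n) r

theorem IsFSZ.of_mulEquiv {G H : Type*} [Group G] [Finite G] [Group H] [Finite H] (e : G ≃* H)
    (h : IsFSZ G) : IsFSZ H := by
  have ncard_eq (m : ℕ) (u g : G) : (powerSet m (e u) (e g)).ncard = (powerSet m u g).ncard := by
    have subset_range : powerSet m (e u) (e g) ⊆ Set.range e := by
      rw [e.surjective.range_eq]
      exact Set.subset_univ _
    rw [← Set.ncard_preimage_of_injective_subset_range e.injective subset_range]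
    simp only [powerSet, Set.preimage_ofPred_eq, ← map_mul, ← map_pow, e.injective.eq_iff]
  intro m hm n hn hcop
  rw [← Nat.card_congr e.toEquiv] at hcop
  refine e.surjective.forall₂.2 fun u g => ?_
  rw [← map_pow, ncard_eq, ncard_eq, h m hm n hn hcop]

end Reduction

section RegularWreathProduct

open Function MulAction MonomialAction

variable {D Q : Type*} [Group D] [Group Q] {p : ℕ}

theorem right_pow (a : D ≀ᵣ Q) (n : ℕ) : (a ^ n).right = a.right ^ n :=
  map_pow RegularWreathProduct.rightHom a n

theorem pow_left_of_right_eq_one {a : D ≀ᵣ Q} (ha : a.right = 1) (n : ℕ) :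
    (a ^ n).left = a.left ^ n := by
  induction n with
  | zero => simp only [pow_zero, RegularWreathProduct.one_left]
  | succ n ih =>
    simp only [pow_succ, RegularWreathProduct.mul_left, ih, right_pow, ha, one_pow, inv_one,
      one_mul, Pi.mul_def]

theorem mem_ker_toPermHom_of_right_eq_one {Ω : Type*} [MulAction D Ω] {a : D ≀ᵣ Q}
    (ha : a.right = 1) (h : ∀ q, a.left q ∈ (toPermHom D Ω).ker) :
    a ∈ (toPermHom (D ≀ᵣ Q) (Ω × Q)).ker :=
  mem_ker_toPermHom.2 fun x => by simp [ha, mem_ker_toPermHom.1 (h _)]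

theorem pow_mem_ker_toPermHom_of_right_eq_one {Ω : Type*} [MulAction D Ω]
    (hD : ∀ d : D, d ^ p ∈ (toPermHom D Ω).ker) {a : D ≀ᵣ Q} (ha : a.right = 1) :
    a ^ p ∈ (toPermHom (D ≀ᵣ Q) (Ω × Q)).ker := by
  refine mem_ker_toPermHom_of_right_eq_one (by rw [right_pow, ha, one_pow]) fun q => ?_
  rw [pow_left_of_right_eq_one ha]
  exact hD (a.left q)

theorem mem_ker_toPermHom_unit_prod {a : D ≀ᵣ Q} (ha : a.right = 1) :
    a ∈ (toPermHom (D ≀ᵣ Q) (Unit × Q)).ker :=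
  mem_ker_toPermHom_of_right_eq_one ha fun _ => mem_ker_toPermHom.2 fun _ => rfl

theorem minimalPeriod_eq_prime_pow_of_right_pow_ne_one {Ω : Type*} [MulAction D Ω] {k : ℕ}
    [Fact p.Prime] {a : D ≀ᵣ Q} (h_ne : a.right ^ p ^ k ≠ 1)
    (h_mem : a ^ p ^ (k + 1) ∈ (toPermHom (D ≀ᵣ Q) (Ω × Q)).ker) (x : Ω × Q) :
    minimalPeriod (a • ·) x = p ^ (k + 1) := by
  refine minimalPeriod_smul_eq_prime_pow (fun h => h_ne ?_) (mem_ker_toPermHom.1 h_mem x)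
  simpa [right_pow] using congrArg Prod.snd h

variable {C Ω : Type*} [Group C] [MulAction D Ω] [Nonempty Ω]

theorem MonomialAction.isPGroup_regularWreathProduct (M : MonomialAction C D Ω)
    (hC : ∀ c : C, c ^ p = 1) (hD : ∀ d : D, d ^ p ∈ (toPermHom D Ω).ker)
    (hQ : ∀ q : Q, q ^ p = 1) : IsPGroup p (D ≀ᵣ Q) := by
  refine fun a => ⟨3, ?_⟩
  rw [pow_succ, pow_mul]
  refine (M.wreath Q).pow_eq_one_of_mem_ker ?_ hC
  rw [pow_two, pow_mul]
  exact pow_mem_ker_toPermHom_of_right_eq_one hD (by rw [right_pow, hQ])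

theorem MonomialAction.isFSZ_regularWreathProduct [Finite D] [Finite Q] [Finite Ω] [Fact p.Prime]
    (M : MonomialAction C D Ω) (hC : ∀ c : C, c ^ p = 1)
    (hD : ∀ d : D, d ^ p ∈ (toPermHom D Ω).ker) (hQ : ∀ q : Q, q ^ p = 1) : IsFSZ (D ≀ᵣ Q) := by
  refine isFSZ_of_forall_ncard_le (M.isPGroup_regularWreathProduct hC hD hQ) fun j u g n => ?_
  obtain _ | k := j
  · refine (onePoint (D ≀ᵣ Q)).ncard_powerSet_le_ncard_powerSet_pow
      (mem_ker_toPermHom.2 fun _ => rfl) (fun a _ x _ => ?_) u n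
    rw [pow_zero]
    exact minimalPeriod_eq_one_iff_isFixedPt.2 rfl
  by_cases hg : g ∈ (toPermHom (D ≀ᵣ Q) (Ω × Q)).ker
  · refine (M.wreath Q).ncard_powerSet_le_ncard_powerSet_pow hg ?_ u n
    rintro a rfl x hx
    exact (M.wreath Q).minimalPeriod_eq_prime_pow_of_pow_mem_ker hC hg hx
  obtain no_root | ⟨b, hb, -⟩ := (powerSet (p ^ (k + 1)) u g).eq_empty_or_nonempty
  · rw [no_root, Set.ncard_empty]
    exact Nat.zero_le _
  have g_mem : g ∈ (toPermHom (D ≀ᵣ Q) (Unit × Q)).ker := by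
    apply mem_ker_toPermHom_unit_prod
    rw [← hb, pow_succ, pow_mul, right_pow, hQ]
  refine ((onePoint D).wreath Q).ncard_powerSet_le_ncard_powerSet_pow g_mem ?_ u n
  rintro a rfl x -
  refine minimalPeriod_eq_prime_pow_of_right_pow_ne_one (fun h_right => hg ?_) g_mem x
  rw [pow_succ, pow_mul]
  exact pow_mem_ker_toPermHom_of_right_eq_one hD (by rwa [right_pow])

end RegularWreathProduct

theorem pow_eq_one_of_natCard_eq {A : Type*} [Group A] {n : ℕ} (hA : Nat.card A = n) (a : A) :
    a ^ n = 1 :=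
  hA ▸ pow_card_eq_one'

end FSZGroups

open FSZGroups in
theorem mainTheorem5_general {C Q R : Type*} [Group C] [Group Q] [Group R] [Finite C] [Finite Q]
    [Finite R] {p : ℕ} [Fact p.Prime] (hC : ∀ c : C, c ^ p = 1) (hQ : ∀ q : Q, q ^ p = 1)
    (hR : ∀ r : R, r ^ p = 1) : IsFSZ ((C ≀ᵣ Q) ≀ᵣ R) :=
  ((MonomialAction.onePoint C).wreath Q).isFSZ_regularWreathProduct hC
    (fun d => mem_ker_toPermHom_unit_prod (by rw [right_pow, hQ])) hR

theorem FSZGroups.isFSZ_sylow_perm {p : ℕ} [Fact p.Prime] {α : Type*} [Finite α]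
    (hα : Nat.card α = p ^ 3) (P : Sylow p (Equiv.Perm α)) : IsFSZ P := by
  let Z := Multiplicative (ZMod p)
  have card_Z : Nat.card Z = p := Nat.card_zmod p
  have card_iterated_one : Nat.card (IteratedWreathProduct Z 1) = p := by
    rw [IteratedWreathProduct.card, card_Z, Finset.sum_range_one, pow_zero, pow_one]
  have h : IsFSZ (IteratedWreathProduct Z 3) :=
    mainTheorem5_general (C := IteratedWreathProduct Z 1)
      (pow_eq_one_of_natCard_eq card_iterated_one) (pow_eq_one_of_natCard_eq card_Z)
      (pow_eq_one_of_natCard_eq card_Z)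
  exact h.of_mulEquiv (P.mulEquivIteratedWreathProduct p 3 α hα Z card_Z).symm

/-- `D ≀ᵣ Q` is the regular wreath product; `Multiplicative (ZMod p)` is the cyclic group of
order `p`, written multiplicatively. -/
theorem mainTheorem5 (p : ℕ) [Fact p.Prime] :
    FSZGroups.IsFSZ
      ((Multiplicative (ZMod p) ≀ᵣ Multiplicative (ZMod p)) ≀ᵣ Multiplicative (ZMod p)) ∧
    ∀ P : Sylow p (Equiv.Perm (Fin (p ^ 3))), FSZGroups.IsFSZ P := by
  have pow_eq_one : ∀ z : Multiplicative (ZMod p), z ^ p = 1 :=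
    FSZGroups.pow_eq_one_of_natCard_eq (Nat.card_zmod p)
  exact ⟨mainTheorem5_general pow_eq_one pow_eq_one pow_eq_one,
    FSZGroups.isFSZ_sylow_perm (Nat.card_fin _)⟩
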